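/- Let $\Sigma$ be an alphabet with at least two letters. A word $u = u[0]\cdots u[n-1] \in \Sigma^n$ has period $p \in \{0,1,\ldots,n-1\}$ if $u[i] = u[i+p]$ for all $0 \le i \le n-p-1$. The autocorrelation of $u$ is the vector $s \in \{0,1\}^n$ with $s[i] = 1$ if $i$ is a period of $u$ and $s[i] = 0$ otherwise $(0 \le i \le n-1)$. Let $\kappa_n$ be the number of distinct autocorrelations of words of length $n$ over $\Sigma$. Then $$\frac{\ln(\kappa_n)}{\ln^2(n)} \longrightarrow \frac{1}{2\ln 2} \qquad \text{as } n \to \infty .$$ -/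

import Mathlib

namespace Autocorr

/-- `p` is a period of the word `u = u[0 .. n-1]`: `0 ≤ p ≤ n-1`, and `u[i] = u[i+p]` for all
`0 ≤ i ≤ n-p-1`. In particular `0` is a period of every non-empty word. -/
def IsPeriod {α : Type*} {n : ℕ} (u : Fin n → α) (p : ℕ) : Prop :=
  p < n ∧ ∀ (i : ℕ) (h : i + p < n), u ⟨i, by omega⟩ = u ⟨i + p, h⟩

open Classical in
/-- The autocorrelation of `u`: the binary vector of length `n` whose entry at position `i`
is one exactly when `i` is a period of `u`. -/
noncomputable def autocorrelation {α : Type*} {n : ℕ} (u : Fin n → α) : Fin n → Bool :=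
  fun i => decide (IsPeriod u (i : ℕ))

/-- The set `Γ_n` of all autocorrelations of words of length `n` over the alphabet `α`. -/
def autocorrelations (α : Type*) (n : ℕ) : Set (Fin n → Bool) :=
  Set.range (fun u : Fin n → α => autocorrelation u)

/-- `κ_n`, the number of autocorrelations of words of length `n` over the alphabet `α`. -/
noncomputable def kappa (α : Type*) (n : ℕ) : ℕ :=
  (autocorrelations α n).ncard

end Autocorr

namespace Autocorr

/-! A period `p` is the same as a border of length `n - p`, so border sets are counted.

Upper bound: a border set is fixed by its least period `p`, its longest border `e < p`, and the
border set `B'` of the prefix of length `e` (`exists_eq_extendBorders`). If `n < 2 * p`, then `p = n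
- e`: one choice `e ≤ n / 2`, a factor `n` per halving, which is the claimed rate. If `2 * p ≤ n`,
choosing `p` and `e` costs `n ^ 2`, affordable while `e` is at most about `n / 4`. For larger `e`,
`p` is recovered from `e`, `n / p ∈ {2, 3}` and one element of `B'` of size at least `e / 2 ^ J`. To
pay for that element, border sets are weighted by the product of their numbers of large borders:
passing to `B'` shifts the levels by one and frees exactly the factor `largeCount J e B'`
(`weightSum_le`). Induction gives `C * exp (c * log n ^ 2)` for each `c > 1 / (2 * log 2)`
(`exists_weightSum_le`).

Lower bound: `v bᵐ v` has the borders of `v` and itself, provided `v` is run-free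
(`borderSet_sandwich`). Doubling the length while choosing `m` among `2 ^ t` values at stage `t`
gives `2 ^ (t * (t - 1) / 2)` border sets at lengths of order `t * 2 ^ t` (`two_pow_le_kappa`). -/

variable {α : Type*}

/-! ### Borders and periods -/

/-- The prefix of length `b` of `u[0 .. n-1]` is also its suffix of length `b`. -/
def IsBorder (u : ℕ → α) (n b : ℕ) : Prop :=
  b ≤ n ∧ ∀ i < b, u i = u (n - b + i)

theorem isBorder_self (u : ℕ → α) (n : ℕ) : IsBorder u n n :=
  ⟨le_rfl, fun i _ => by simp⟩

theorem isBorder_zero (u : ℕ → α) (n : ℕ) : IsBorder u n 0 :=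
  ⟨n.zero_le, fun i hi => by omega⟩

theorem IsBorder.iff_of_le {u : ℕ → α} {n b c : ℕ} (hb : IsBorder u n b) (hc : c ≤ b) :
    IsBorder u b c ↔ IsBorder u n c := by
  have key : ∀ i < c, u (b - c + i) = u (n - c + i) := fun i hi => by
    rw [hb.2 (b - c + i) (by omega)]
    congr 1
    have := hb.1
    omega
  constructor
  · rintro ⟨_, h⟩
    exact ⟨hc.trans hb.1, fun i hi => (h i hi).trans (key i hi)⟩
  · rintro ⟨_, h⟩
    exact ⟨hc, fun i hi => (h i hi).trans (key i hi).symm⟩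

theorem isBorder_sub_iff {u : ℕ → α} {n p : ℕ} (hp : p ≤ n) :
    IsBorder u n (n - p) ↔ ∀ i, i + p < n → u i = u (i + p) := by
  constructor
  · rintro ⟨_, h⟩ i hi
    rw [h i (by omega)]
    congr 1
    omega
  · intro h
    refine ⟨n.sub_le p, fun i hi => ?_⟩
    rw [h i (by omega)]
    congr 1
    omega

theorem IsBorder.sub_mul {u : ℕ → α} {n p : ℕ} (h : IsBorder u n (n - p)) (hp : p ≤ n) (j : ℕ)
    (hj : j * p ≤ n) : IsBorder u n (n - j * p) := by
  rw [isBorder_sub_iff hp] at h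
  rw [isBorder_sub_iff hj]
  clear hj
  induction j with
  | zero => simp
  | succ j ih =>
    intro i hi
    rw [add_mul, one_mul] at hi ⊢
    rw [ih i (by omega), h (i + j * p) (by omega)]
    congr 1
    omega

/-- The Euclidean step: move back by `p` and forward by `q`, or in the other order when `i < p`;
then `p + q ≤ n` keeps `i + q` inside the word. -/
theorem IsBorder.sub_sub {u : ℕ → α} {n p q : ℕ} (hp : IsBorder u n (n - p))
    (hq : IsBorder u n (n - q)) (hpq : p ≤ q) (hn : p + q ≤ n) :
    IsBorder u n (n - (q - p)) := by
  rw [isBorder_sub_iff (by omega)] at *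
  intro i hi
  by_cases hip : p ≤ i
  · have h1 := hp (i - p) (by omega)
    have h2 := hq (i - p) (by omega)
    rw [Nat.sub_add_cancel hip] at h1
    rw [← h1, h2]
    congr 1
    omega
  · rw [hq i (by omega), hp (i + (q - p)) (by omega)]
    congr 1
    omega

/-- The part of the Fine–Wilf theorem that concerns the least period. -/
theorem IsBorder.dvd_of_minimal {u : ℕ → α} {n p : ℕ} (hp : IsBorder u n (n - p))
    (hp0 : 0 < p) (hmin : ∀ q, 0 < q → q < p → ¬ IsBorder u n (n - q)) :
    ∀ q, IsBorder u n (n - q) → p + q ≤ n → p ∣ q := by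
  intro q
  induction q using Nat.strong_induction_on with
  | _ q ih =>
    intro hq hn
    rcases Nat.eq_zero_or_pos q with rfl | hq0
    · exact dvd_zero p
    rcases lt_or_ge q p with h | h
    · exact absurd hq (hmin q hq0 h)
    · have := ih (q - p) (by omega) (hp.sub_sub hq h hn) (by omega)
      exact (Nat.dvd_sub_iff_left h dvd_rfl).1 this

/-! ### Border sets and their correspondence with autocorrelations -/

open Classical in
/-- The set of all borders of `u[0 .. n-1]`, including `0` and `n`. -/
noncomputable def borderSet (u : ℕ → α) (n : ℕ) : Finset ℕ :=
  (Finset.range (n + 1)).filter (IsBorder u n)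

theorem mem_borderSet {u : ℕ → α} {n b : ℕ} : b ∈ borderSet u n ↔ IsBorder u n b := by
  classical
  rw [borderSet, Finset.mem_filter, Finset.mem_range, and_iff_right_iff_imp]
  exact fun h => Nat.lt_succ_of_le h.1

open Classical in
/-- The family of all border sets of words of length `n`. -/
noncomputable def borderSets (α : Type*) (n : ℕ) : Finset (Finset ℕ) :=
  (Finset.range (n + 1)).powerset.filter (fun B => ∃ u : ℕ → α, borderSet u n = B)

theorem mem_borderSets {n : ℕ} {B : Finset ℕ} :
    B ∈ borderSets α n ↔ ∃ u : ℕ → α, borderSet u n = B := by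
  classical
  simp only [borderSets, Finset.mem_filter, Finset.mem_powerset, and_iff_right_iff_imp]
  rintro ⟨u, rfl⟩ b hb
  exact Finset.mem_range_succ_iff.2 (mem_borderSet.1 hb).1

theorem self_mem_of_mem_borderSets {n : ℕ} {B : Finset ℕ} (h : B ∈ borderSets α n) : n ∈ B := by
  obtain ⟨u, rfl⟩ := mem_borderSets.1 h
  exact mem_borderSet.2 (isBorder_self u n)

theorem le_of_mem_borderSets {n b : ℕ} {B : Finset ℕ} (h : B ∈ borderSets α n) (hb : b ∈ B) :
    b ≤ n := by
  obtain ⟨u, rfl⟩ := mem_borderSets.1 h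
  exact (mem_borderSet.1 hb).1

/-- The border set with given autocorrelation. -/
def bordersOfVector {n : ℕ} (s : Fin n → Bool) : Finset ℕ :=
  insert 0 ((Finset.univ.filter (fun i => s i = true)).image (fun i : Fin n => n - (i : ℕ)))

theorem mem_bordersOfVector {n b : ℕ} {s : Fin n → Bool} :
    b ∈ bordersOfVector s ↔ b = 0 ∨ ∃ i : Fin n, s i = true ∧ n - (i : ℕ) = b := by
  simp [bordersOfVector]

theorem bordersOfVector_injective {n : ℕ} :
    Function.Injective (bordersOfVector : (Fin n → Bool) → Finset ℕ) := by
  have key : ∀ (s : Fin n → Bool) (i : Fin n), n - (i : ℕ) ∈ bordersOfVector s ↔ s i = true := by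
    intro s i
    have hi := i.2
    rw [mem_bordersOfVector]
    constructor
    · rintro (h | ⟨j, hj, h⟩)
      · omega
      · have hj' := j.2
        have : j = i := Fin.ext (by omega)
        exact this ▸ hj
    · exact fun h => Or.inr ⟨i, h, rfl⟩
  intro s t h
  funext i
  rw [Bool.eq_iff_iff, ← key s i, ← key t i, h]

theorem bordersOfVector_autocorrelation {n : ℕ} (u : ℕ → α) :
    bordersOfVector (autocorrelation (fun i : Fin n => u i)) = borderSet u n := by
  ext b
  simp only [mem_bordersOfVector, autocorrelation, mem_borderSet, decide_eq_true_eq]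
  constructor
  · rintro (rfl | ⟨i, ⟨_, h⟩, rfl⟩)
    · exact isBorder_zero u n
    · exact (isBorder_sub_iff i.2.le).2 h
  · intro h
    rcases Nat.eq_zero_or_pos b with rfl | hb
    · exact Or.inl rfl
    · have hbn := h.1
      refine Or.inr ⟨⟨n - b, by omega⟩, ⟨by simp; omega, ?_⟩, by simp; omega⟩
      refine (isBorder_sub_iff (u := u) (n.sub_le b)).1 ?_
      rwa [Nat.sub_sub_self hbn]

theorem kappa_eq_card [Nonempty α] (n : ℕ) : kappa α n = (borderSets α n).card := by
  rw [kappa, ← Set.ncard_image_of_injective _ bordersOfVector_injective, ← Set.ncard_coe_finset]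
  congr 1
  ext B
  simp only [autocorrelations, Set.mem_image, Set.mem_range, Finset.mem_coe, mem_borderSets]
  constructor
  · rintro ⟨_, ⟨v, rfl⟩, rfl⟩
    refine ⟨fun i => if h : i < n then v ⟨i, h⟩ else Classical.arbitrary α, ?_⟩
    rw [← bordersOfVector_autocorrelation]
    simp
  · rintro ⟨u, rfl⟩
    exact ⟨_, ⟨fun i => u i, rfl⟩, bordersOfVector_autocorrelation u⟩

/-! ### Recursive structure of a border set -/

/-- Adjoin to `B` the numbers in `[p, n]` that are congruent to `n` modulo `p`. -/
def extendBorders (n p : ℕ) (B : Finset ℕ) : Finset ℕ :=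
  B ∪ (Finset.range (n + 1)).filter (fun b => p ≤ b ∧ p ∣ n - b)

/-- A border set consists of the borders below the least period `p`, which form the border set of
a shorter word, and of an arithmetic progression with difference `p`. -/
theorem exists_eq_extendBorders {n : ℕ} (hn : 0 < n) {B : Finset ℕ} (hB : B ∈ borderSets α n) :
    ∃ p e B', 0 < p ∧ p ≤ n ∧ e < p ∧ 2 * e ≤ n ∧ B' ∈ borderSets α e ∧ B = extendBorders n p B' ∧
      (n < 2 * p → p = n - e) ∧ n % p ∈ B' ∧
      (p + n % p < 2 * e → 2 * e - (p + n % p) ∈ B') := by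
  obtain ⟨u, rfl⟩ := mem_borderSets.1 hB
  obtain ⟨b₀, hb₀, hmax₀⟩ := Finset.exists_max_image ((borderSet u n).filter (· < n)) id
    ⟨0, Finset.mem_filter.2 ⟨mem_borderSet.2 (isBorder_zero u n), hn⟩⟩
  simp only [Finset.mem_filter, mem_borderSet, id] at hb₀ hmax₀
  obtain ⟨hb₀, hb₀n⟩ := hb₀
  obtain ⟨p, hp⟩ : ∃ p, p = n - b₀ := ⟨_, rfl⟩
  have hp0 : 0 < p := by omega
  have hpn : p ≤ n := by omega
  have hbp : IsBorder u n (n - p) := by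
    rwa [hp, Nat.sub_sub_self hb₀n.le]
  have hmin : ∀ q, 0 < q → q < p → ¬ IsBorder u n (n - q) := fun q h0 hq h => by
    have := hmax₀ (n - q) ⟨h, by omega⟩
    omega
  obtain ⟨e, he, hmax⟩ := Finset.exists_max_image ((borderSet u n).filter (· < p)) id
    ⟨0, Finset.mem_filter.2 ⟨mem_borderSet.2 (isBorder_zero u n), hp0⟩⟩
  simp only [Finset.mem_filter, mem_borderSet, id] at he hmax
  obtain ⟨he, hep⟩ := he
  have hmod : n % p + p * (n / p) = n := Nat.mod_add_div n p
  have hk : 1 ≤ n / p := (Nat.one_le_div_iff hp0).2 hpn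
  have hrp : n % p < p := Nat.mod_lt n hp0
  have hr : IsBorder u n (n % p) := by
    have := hbp.sub_mul hpn (n / p) (by rw [mul_comm]; omega)
    rwa [mul_comm, show n - p * (n / p) = n % p by omega] at this
  have hre : n % p ≤ e := hmax _ ⟨hr, hrp⟩
  have hlarge : n < 2 * p → p = n - e := fun h => by
    have h1 := hmax (n - p) ⟨hbp, by omega⟩
    have h2 := hmax₀ e ⟨he, by omega⟩
    omega
  refine ⟨p, e, borderSet u e, hp0, hpn, hep, ?_, mem_borderSets.2 ⟨u, rfl⟩, ?_, hlarge,
    mem_borderSet.2 ((he.iff_of_le hre).2 hr), ?_⟩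
  · by_contra h
    have := hlarge (by omega)
    omega
  · ext b
    simp only [extendBorders, Finset.mem_union, Finset.mem_filter, Finset.mem_range, mem_borderSet]
    constructor
    · intro hb
      have hbn := hb.1
      rcases lt_or_ge b p with h | h
      · exact Or.inl ((he.iff_of_le (hmax b ⟨hb, h⟩)).2 hb)
      -- Since `b ≥ p`, the period `n - b` satisfies `p + (n - b) ≤ n`, as Fine–Wilf requires.
      · refine Or.inr ⟨by omega, h, hbp.dvd_of_minimal hp0 hmin (n - b) ?_ (by omega)⟩
        rwa [Nat.sub_sub_self hbn]
    · rintro (hb | ⟨hbn, hb, j, hj⟩)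
      · exact (he.iff_of_le hb.1).1 hb
      · have := hbp.sub_mul hpn j (by rw [mul_comm]; omega)
        rwa [mul_comm, ← hj, Nat.sub_sub_self (by omega)] at this
  · intro hlt
    -- The border of length `e` is prefix and suffix of the prefix of length `p + n % p`; the
    -- overlap of these two occurrences is a border of it.
    have hw : IsBorder u n (p + n % p) := by
      obtain ⟨j, hj⟩ : ∃ j, n / p = j + 1 := ⟨n / p - 1, by omega⟩
      rw [hj, mul_add, mul_one] at hmod
      have := hbp.sub_mul hpn j (by rw [mul_comm]; omega)
      rwa [mul_comm, show n - p * j = p + n % p by omega] at this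
    have hew : IsBorder u (p + n % p) e := (hw.iff_of_le (by omega)).2 he
    refine mem_borderSet.2 ⟨by omega, fun i hi => ?_⟩
    rw [hew.2 i (by omega)]
    congr 1
    omega

/-! ### Weights counting large borders -/

/-- The number of elements of `B` that are at least `n / 2 ^ l`. -/
def largeCount (l n : ℕ) (B : Finset ℕ) : ℕ :=
  (B.filter (fun b => n ≤ 2 ^ l * b)).card

theorem largeCount_zero {n : ℕ} {B : Finset ℕ} (hB : B ∈ borderSets α n) :
    largeCount 0 n B = 1 := by
  rw [largeCount, Finset.card_eq_one]
  refine ⟨n, ?_⟩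
  ext b
  simp only [pow_zero, one_mul, Finset.mem_filter, Finset.mem_singleton]
  constructor
  · rintro ⟨hb, h⟩
    exact le_antisymm (le_of_mem_borderSets hB hb) h
  · rintro rfl
    exact ⟨self_mem_of_mem_borderSets hB, le_rfl⟩

theorem one_le_largeCount {n : ℕ} {B : Finset ℕ} (hB : n ∈ B) (l : ℕ) :
    1 ≤ largeCount l n B :=
  Finset.card_pos.2 ⟨n, Finset.mem_filter.2 ⟨hB, Nat.le_mul_of_pos_left n (by positivity)⟩⟩

/-- Because `2 * e ≤ n`, the threshold `n / 2 ^ (l + 1)` is at least `e / 2 ^ l`; the progression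
adds at most `n / p` terms. -/
theorem largeCount_succ_le {n p e : ℕ} (hp : 0 < p) (he : 2 * e ≤ n) (B : Finset ℕ) (l : ℕ) :
    largeCount (l + 1) n (extendBorders n p B) ≤ n / p + largeCount l e B := by
  rw [largeCount, extendBorders, Finset.filter_union, add_comm (n / p)]
  refine (Finset.card_union_le _ _).trans (add_le_add (Finset.card_le_card fun b hb => ?_) ?_)
  · simp only [Finset.mem_filter] at hb ⊢
    refine ⟨hb.1, ?_⟩
    have := hb.2
    rw [pow_succ, mul_comm (2 ^ l), mul_assoc] at this
    omega
  · refine (Finset.card_le_card (t := (Finset.range (n / p)).image (fun j => n - p * j))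
      fun b hb => ?_).trans (Finset.card_image_le.trans (Finset.card_range _).le)
    simp only [Finset.mem_filter, Finset.mem_range, Finset.mem_image] at hb ⊢
    obtain ⟨⟨hbn, hpb, j, hj⟩, -⟩ := hb
    refine ⟨j, ?_, by omega⟩
    rw [← Nat.succ_le_iff, Nat.le_div_iff_mul_le hp, Nat.succ_mul, mul_comm]
    omega

/-- The product of the numbers of borders of length at least `n / 2 ^ l`, for `l ≤ J`. -/
def borderWeight (J n : ℕ) (B : Finset ℕ) : ℕ :=
  ∏ l ∈ Finset.range (J + 1), largeCount l n B

theorem one_le_borderWeight {n : ℕ} {B : Finset ℕ} (hB : n ∈ B) (J : ℕ) :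
    1 ≤ borderWeight J n B :=
  Finset.one_le_prod' fun l _ => one_le_largeCount hB l

theorem borderWeight_eq (J n : ℕ) (B : Finset ℕ) :
    borderWeight J n B = (∏ l ∈ Finset.range J, largeCount l n B) * largeCount J n B :=
  Finset.prod_range_succ _ _

theorem prod_largeCount_le_borderWeight {n : ℕ} {B : Finset ℕ} (hB : n ∈ B) (J : ℕ) :
    ∏ l ∈ Finset.range J, largeCount l n B ≤ borderWeight J n B := by
  rw [borderWeight_eq]
  exact Nat.le_mul_of_pos_right _ (one_le_largeCount hB J)

theorem borderWeight_extendBorders_le {n p e : ℕ} (hp : 0 < p) (he : 2 * e ≤ n) {B : Finset ℕ}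
    (hB : B ∈ borderSets α e) (hE : extendBorders n p B ∈ borderSets α n) (J : ℕ) :
    borderWeight J n (extendBorders n p B) ≤
      (n / p + 1) ^ J * ∏ l ∈ Finset.range J, largeCount l e B := by
  rw [borderWeight, Finset.prod_range_succ', largeCount_zero hE, mul_one]
  calc ∏ l ∈ Finset.range J, largeCount (l + 1) n (extendBorders n p B)
      ≤ ∏ l ∈ Finset.range J, (n / p + 1) * largeCount l e B := by
        refine Finset.prod_le_prod' fun l _ => (largeCount_succ_le hp he B l).trans ?_
        have h1 := one_le_largeCount (self_mem_of_mem_borderSets hB) l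
        nlinarith [Nat.mul_le_mul_left (n / p) h1]
    _ = _ := by rw [Finset.prod_mul_distrib, Finset.prod_const, Finset.card_range]

/-! ### Recursive inequality for the total weight -/

/-- The sum of the weights of all border sets of words of length `n`. -/
noncomputable def weightSum (α : Type*) (J n : ℕ) : ℕ :=
  ∑ B ∈ borderSets α n, borderWeight J n B

theorem card_le_weightSum (J n : ℕ) : (borderSets α n).card ≤ weightSum α J n := by
  rw [Finset.card_eq_sum_ones]
  exact Finset.sum_le_sum fun B hB => one_le_borderWeight (self_mem_of_mem_borderSets hB) J

/-- Here `d` decodes: choosing one code for each `b` is automatically injective. -/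
theorem sum_le_sum_of_forall_exists {β γ : Type*} {s : Finset β} {t : Finset γ}
    {f : β → ℕ} {g : γ → ℕ} (d : γ → β) (h : ∀ b ∈ s, ∃ c ∈ t, d c = b ∧ f b ≤ g c) :
    ∑ b ∈ s, f b ≤ ∑ c ∈ t, g c := by
  classical
  rcases s.eq_empty_or_nonempty with rfl | ⟨b₀, hb₀⟩
  · simp
  obtain ⟨c₀, -⟩ := h b₀ hb₀
  have : Nonempty γ := ⟨c₀⟩
  choose! r hrt hdr hfg using h
  have hinj : Set.InjOn r s := fun a ha b hb hab => by
    rw [← hdr a ha, ← hdr b hb, hab]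
  calc ∑ b ∈ s, f b ≤ ∑ b ∈ s, g (r b) := Finset.sum_le_sum hfg
    _ = ∑ c ∈ s.image r, g c := (Finset.sum_image hinj).symm
    _ ≤ ∑ c ∈ t, g c := Finset.sum_le_sum_of_subset (Finset.image_subset_iff.2 hrt)

theorem sum_le_add_of_forall_exists {β γ₁ γ₂ γ₃ : Type*} {s : Finset β} {t₁ : Finset γ₁}
    {t₂ : Finset γ₂} {t₃ : Finset γ₃} {f : β → ℕ} {g₁ : γ₁ → ℕ} {g₂ : γ₂ → ℕ} {g₃ : γ₃ → ℕ}
    (d₁ : γ₁ → β) (d₂ : γ₂ → β) (d₃ : γ₃ → β)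
    (h : ∀ b ∈ s, (∃ c ∈ t₁, d₁ c = b ∧ f b ≤ g₁ c) ∨ (∃ c ∈ t₂, d₂ c = b ∧ f b ≤ g₂ c) ∨
      (∃ c ∈ t₃, d₃ c = b ∧ f b ≤ g₃ c)) :
    ∑ b ∈ s, f b ≤ ∑ c ∈ t₁, g₁ c + (∑ c ∈ t₂, g₂ c + ∑ c ∈ t₃, g₃ c) := by
  have := sum_le_sum_of_forall_exists (s := s) (f := f) (t := t₁.disjSum (t₂.disjSum t₃))
    (g := Sum.elim g₁ (Sum.elim g₂ g₃)) (Sum.elim d₁ (Sum.elim d₂ d₃)) fun b hb => by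
      rcases h b hb with ⟨c, hc, h⟩ | ⟨c, hc, h⟩ | ⟨c, hc, h⟩
      · exact ⟨Sum.inl c, by simpa using hc, h⟩
      · exact ⟨Sum.inr (Sum.inl c), by simpa using hc, h⟩
      · exact ⟨Sum.inr (Sum.inr c), by simpa using hc, h⟩
  simpa [Finset.sum_disjSum] using this

/-- The pairs of a period `p ≤ n / 2` and a border `e < p` of length at most about `n / 4`. -/
def shortPairs (J n : ℕ) : Finset (ℕ × ℕ) :=
  (Finset.range (n / 2 + 1) ×ˢ Finset.range (n / 2 + 1)).filter
    (fun q => q.2 < q.1 ∧ 4 * q.2 * 2 ^ J ≤ (2 ^ J + 2) * n)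

/-- The least period of a word of length `n`, recovered from a border `e`, the exponent `k`, and
either the residue `s` or the length `s` of an overlap. -/
def recoverPeriod (n e k : ℕ) (overlap : Bool) (s : ℕ) : ℕ :=
  if overlap then (n + s - 2 * e) / (k - 1) else (n - s) / k

/-- Three codes cover all border sets: `e` alone when `n < 2 * p`, the pair `(p, e)` when `e` is
short, and otherwise `e` with the exponent, a flag and a large border `s` of the prefix of length
`e`. -/
theorem weightSum_le {n : ℕ} (hn : 0 < n) (J : ℕ) :
    weightSum α J n ≤ (2 ^ J + 4 ^ (J + 1)) * ∑ e ∈ Finset.range (n / 2 + 1), weightSum α J e +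
      ∑ q ∈ shortPairs J n, (n / q.1 + 1) ^ J * weightSum α J q.2 := by
  classical
  have hmain := sum_le_add_of_forall_exists (s := borderSets α n) (f := borderWeight J n)
    (t₁ := (Finset.range (n / 2 + 1)).sigma (fun e => borderSets α e))
    (t₂ := (shortPairs J n).sigma (fun q => borderSets α q.2))
    (t₃ := (Finset.range (n / 2 + 1)).sigma (fun e => (borderSets α e).sigma (fun B =>
      ({2, 3} : Finset ℕ) ×ˢ ((Finset.univ : Finset Bool) ×ˢ
        B.filter (fun b => e ≤ 2 ^ J * b)))))
    (g₁ := fun c => 2 ^ J * borderWeight J c.1 c.2)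
    (g₂ := fun c => (n / c.1.1 + 1) ^ J * borderWeight J c.1.2 c.2)
    (g₃ := fun c => 4 ^ J * ∏ l ∈ Finset.range J, largeCount l c.1 c.2.1)
    (fun c => extendBorders n (n - c.1) c.2)
    (fun c => extendBorders n c.1.1 c.2)
    (fun c => extendBorders n (recoverPeriod n c.1 c.2.2.1 c.2.2.2.1 c.2.2.2.2) c.2.1) ?_
  · refine hmain.trans (le_of_eq ?_)
    simp only [Finset.sum_sigma, ← Finset.mul_sum, weightSum]
    simp only [Finset.sum_const, Finset.card_product, Finset.card_univ, Fintype.card_bool,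
      smul_eq_mul, Finset.card_pair (show (2 : ℕ) ≠ 3 by decide)]
    -- Two exponents, two flags and `largeCount J e B` values of `s`; the last number completes the
    -- truncated product to the full weight.
    have : ∀ e, ∑ B ∈ borderSets α e, 2 * (2 * (B.filter (fun b => e ≤ 2 ^ J * b)).card) *
        ∏ l ∈ Finset.range J, largeCount l e B =
        4 * ∑ B ∈ borderSets α e, borderWeight J e B := fun e => by
      rw [Finset.mul_sum]
      refine Finset.sum_congr rfl fun B _ => ?_
      rw [borderWeight_eq, show (B.filter (fun b => e ≤ 2 ^ J * b)).card = largeCount J e B from rfl]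
      ring
    simp only [this, ← Finset.mul_sum]
    ring
  intro B hB
  obtain ⟨p, e, B', hp0, hpn, hep, he2, hB', rfl, hlarge, hr, ht⟩ := exists_eq_extendBorders hn hB
  have hW := borderWeight_extendBorders_le hp0 he2 hB' hB J
  have hle := prod_largeCount_le_borderWeight (self_mem_of_mem_borderSets hB') J
  rcases lt_or_ge n (2 * p) with h2p | h2p
  · left
    refine ⟨⟨e, B'⟩, ?_, ?_, ?_⟩
    · simp only [Finset.mem_sigma, Finset.mem_range]
      exact ⟨by omega, hB'⟩
    · simp only [← hlarge h2p]
    · have : n / p = 1 := Nat.div_eq_of_lt_le (by omega) (by omega)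
      rw [this] at hW
      exact hW.trans (Nat.mul_le_mul_left _ hle)
  right
  by_cases hshort : 4 * e * 2 ^ J ≤ (2 ^ J + 2) * n
  · left
    refine ⟨⟨(p, e), B'⟩, ?_, rfl, hW.trans (Nat.mul_le_mul_left _ hle)⟩
    simp only [Finset.mem_sigma, shortPairs, Finset.mem_filter, Finset.mem_product,
      Finset.mem_range]
    exact ⟨⟨by omega, hep, hshort⟩, hB'⟩
  right
  push Not at hshort
  have hpow : 0 < 2 ^ J := by positivity
  have hne : n < 4 * e := by
    by_contra h
    have := Nat.mul_le_mul_right (2 ^ J) (not_lt.1 h)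
    nlinarith
  have hmod : n % p + p * (n / p) = n := Nat.mod_add_div n p
  have hrp : n % p < p := Nat.mod_lt n hp0
  have hk2 : 2 ≤ n / p := (Nat.le_div_iff_mul_le hp0).2 h2p
  have hk4 : n / p < 4 := (Nat.div_lt_iff_lt_mul hp0).2 (by omega)
  have hk : n / p ∈ ({2, 3} : Finset ℕ) := by
    simp only [Finset.mem_insert, Finset.mem_singleton]
    omega
  have hW4 : borderWeight J n (extendBorders n p B') ≤
      4 ^ J * ∏ l ∈ Finset.range J, largeCount l e B' :=
    hW.trans (Nat.mul_le_mul_right _ (Nat.pow_le_pow_left (by omega) J))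
  have hs : ∀ f s, s ∈ B' → e ≤ 2 ^ J * s → recoverPeriod n e (n / p) f s = p →
      ∃ c ∈ ((Finset.range (n / 2 + 1)).sigma (fun e => (borderSets α e).sigma (fun B =>
        ({2, 3} : Finset ℕ) ×ˢ ((Finset.univ : Finset Bool) ×ˢ
          B.filter (fun b => e ≤ 2 ^ J * b))))),
        extendBorders n (recoverPeriod n c.1 c.2.2.1 c.2.2.2.1 c.2.2.2.2) c.2.1 =
          extendBorders n p B' ∧
        borderWeight J n (extendBorders n p B') ≤
          4 ^ J * ∏ l ∈ Finset.range J, largeCount l c.1 c.2.1 := by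
    intro f s hsB hse hf
    refine ⟨⟨e, B', n / p, f, s⟩, ?_, by simp only [hf], hW4⟩
    simp only [Finset.mem_sigma, Finset.mem_product, Finset.mem_filter, Finset.mem_univ,
      Finset.mem_range]
    exact ⟨by omega, hB', hk, trivial, hsB, hse⟩
  by_cases hrl : e ≤ 2 ^ J * (n % p)
  · refine hs false (n % p) hr hrl ?_
    rw [recoverPeriod, if_neg (by simp), show n - n % p = p * (n / p) by omega,
      Nat.mul_div_cancel _ (by omega)]
  -- With the residue small and `4 * e` exceeding `n` by more than `2 * n / 2 ^ J`, the inequality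
  -- `2 * (p + n % p) ≤ n + n % p` forces a large overlap.
  · push Not at hrl
    have h2r : 2 * (p + n % p) ≤ n + n % p := by nlinarith
    have hover : p + n % p < 2 * e := by
      by_contra h
      have h4 : 4 * e ≤ n + n % p := by omega
      have := Nat.mul_le_mul_right (2 ^ J) h4
      nlinarith
    refine hs true _ (ht hover) ?_ ?_
    · obtain ⟨t, htt⟩ : ∃ t, 2 * e = p + n % p + t := ⟨2 * e - (p + n % p), by omega⟩
      rw [show 2 * e - (p + n % p) = t by omega]
      have h4 : 4 * e ≤ n + n % p + 2 * t := by omega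
      have := Nat.mul_le_mul_right (2 ^ J) h4
      nlinarith
    · have : n + (2 * e - (p + n % p)) - 2 * e = p * (n / p - 1) := by
        rw [Nat.mul_sub_one]
        omega
      rw [recoverPeriod, if_pos rfl, this, Nat.mul_div_cancel _ (by omega)]

/-! ### Solving the recursion -/

theorem log_le_log_sub_log_two {n e : ℕ} (hn : 2 ≤ n) (he : e ≤ n / 2) :
    Real.log e ≤ Real.log n - Real.log 2 := by
  have hn' : (2 : ℝ) ≤ n := by exact_mod_cast hn
  rw [← Real.log_div (by positivity) two_ne_zero]
  rcases Nat.eq_zero_or_pos e with rfl | h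
  · rw [Nat.cast_zero, Real.log_zero]
    exact Real.log_nonneg (by linarith)
  · refine Real.log_le_log (by positivity) ?_
    rw [le_div_iff₀ two_pos]
    exact_mod_cast (Nat.le_div_iff_mul_le two_pos).1 he

/-- At most `n = exp L` terms, while halving saves `2 * c * log 2 * L` in the exponent, more than
`L` when `2 * c * log 2 > 1`. -/
theorem sum_exp_sq_log_le {c A L : ℝ} {n : ℕ} (hc : 0 < c) (hA : 0 < A) (hn : 2 ≤ n)
    (hL : L = Real.log n)
    (h : Real.log (2 * A) + c * Real.log 2 ^ 2 ≤ (2 * c * Real.log 2 - 1) * L) :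
    A * ∑ e ∈ Finset.range (n / 2 + 1), Real.exp (c * Real.log e ^ 2) ≤
      Real.exp (c * L ^ 2) / 2 := by
  have hn0 : (0 : ℝ) < n := by exact_mod_cast (by omega : 0 < n)
  have hterm : ∀ e ∈ Finset.range (n / 2 + 1), Real.exp (c * Real.log e ^ 2) ≤
      Real.exp (c * (L - Real.log 2) ^ 2) := fun e he => by
    have h1 := log_le_log_sub_log_two hn (Nat.lt_succ_iff.1 (Finset.mem_range.1 he))
    have h0 : 0 ≤ Real.log e := Real.log_natCast_nonneg e
    rw [hL]
    gcongr
  have hsum := Finset.sum_le_card_nsmul _ _ _ hterm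
  rw [Finset.card_range, nsmul_eq_mul] at hsum
  have hcard : ((n / 2 + 1 : ℕ) : ℝ) ≤ n := by exact_mod_cast (by omega : n / 2 + 1 ≤ n)
  calc A * ∑ e ∈ Finset.range (n / 2 + 1), Real.exp (c * Real.log e ^ 2)
      ≤ A * (n * Real.exp (c * (L - Real.log 2) ^ 2)) := by
        gcongr
        exact hsum.trans (by gcongr)
    _ = Real.exp (Real.log (2 * A) + L + c * (L - Real.log 2) ^ 2) / 2 := by
        rw [Real.exp_add, Real.exp_add, Real.exp_log (by positivity), hL, Real.exp_log hn0]
        ring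
    _ ≤ _ := by
        gcongr
        nlinarith

/-- At most `n ^ 2` pairs cost `2 * L`; the drop of `log e` by at least `x₀`, close to `log 4`,
saves about `2 * c * x₀ * L`. -/
theorem sum_shortPairs_le {c x₀ L : ℝ} {n J : ℕ} (hc : 0 < c) (hn : 2 ≤ n)
    (hL : L = Real.log n) (hx₀L : x₀ ≤ L)
    (hx : x₀ = 2 * Real.log 2 - Real.log (1 + 2 / 2 ^ J))
    (h₁ : 0 ≤ c * L - c * x₀ - J)
    (h₂ : (J + 1) * Real.log 2 + c * x₀ ^ 2 + J * x₀ ≤ (2 * c * x₀ - 2) * L) :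
    ∑ q ∈ shortPairs J n, ((n / q.1 : ℕ) + 1 : ℝ) ^ J * Real.exp (c * Real.log q.2 ^ 2) ≤
      Real.exp (c * L ^ 2) / 2 := by
  have hn0 : (0 : ℝ) < n := by exact_mod_cast (by omega : 0 < n)
  have hterm : ∀ q ∈ shortPairs J n,
      ((n / q.1 : ℕ) + 1 : ℝ) ^ J * Real.exp (c * Real.log q.2 ^ 2) ≤
        Real.exp (c * L ^ 2 - 2 * L - Real.log 2) := by
    rintro ⟨p, e⟩ hq
    simp only [shortPairs, Finset.mem_filter, Finset.mem_product, Finset.mem_range] at hq ⊢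
    obtain ⟨⟨hp, he⟩, hep, hshort⟩ := hq
    have hp0 : (0 : ℝ) < p := by exact_mod_cast (by omega : 0 < p)
    have hpn : (p : ℝ) ≤ n := by exact_mod_cast (by omega : p ≤ n)
    have he0 : 0 ≤ Real.log e := Real.log_natCast_nonneg e
    obtain ⟨x, hxe⟩ : ∃ x, x = L - Real.log e := ⟨_, rfl⟩
    have hxL : x ≤ L := by linarith
    have hx₀x : x₀ ≤ x := by
      -- For `e = 0` the convention `Real.log 0 = 0` gives `x = L`, whence the hypothesis `x₀ ≤ L`.
      rcases Nat.eq_zero_or_pos e with rfl | hepos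
      · rw [hxe, Nat.cast_zero, Real.log_zero, sub_zero]
        exact hx₀L
      · have he' : (0 : ℝ) < e := by exact_mod_cast hepos
        have hreal : (4 : ℝ) * e * 2 ^ J ≤ (2 ^ J + 2) * n := by exact_mod_cast hshort
        have hle : 4 * (e : ℝ) ≤ (1 + 2 / 2 ^ J) * n := by
          rw [← mul_le_mul_iff_left₀ (show (0 : ℝ) < 2 ^ J by positivity)]
          refine hreal.trans (le_of_eq ?_)
          field_simp
        have := Real.log_le_log (by positivity) hle
        rw [Real.log_mul (by norm_num) he'.ne', Real.log_mul (by positivity) hn0.ne',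
          show (4 : ℝ) = 2 ^ 2 by norm_num, Real.log_pow] at this
        push_cast at this
        linarith
    have hbase : ((n / p : ℕ) + 1 : ℝ) ≤ Real.exp (Real.log 2 + x) := by
      have h1 : ((n / p : ℕ) : ℝ) ≤ n / p := Nat.cast_div_le
      have h2 : (1 : ℝ) ≤ n / p := (one_le_div hp0).2 hpn
      have h3 : Real.log e ≤ Real.log p := by
        rcases Nat.eq_zero_or_pos e with rfl | hepos
        · rw [Nat.cast_zero, Real.log_zero]
          exact Real.log_natCast_nonneg p
        · exact Real.log_le_log (by exact_mod_cast hepos) (by exact_mod_cast hep.le)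
      have h4 : (n / p : ℝ) ≤ Real.exp x := by
        rw [← Real.log_le_iff_le_exp (by positivity), Real.log_div hn0.ne' hp0.ne']
        linarith
      rw [Real.exp_add, Real.exp_log two_pos]
      linarith
    calc ((n / p : ℕ) + 1 : ℝ) ^ J * Real.exp (c * Real.log e ^ 2)
        ≤ Real.exp (Real.log 2 + x) ^ J * Real.exp (c * Real.log e ^ 2) := by gcongr
      _ = Real.exp (J * (Real.log 2 + x) + c * (L - x) ^ 2) := by
        rw [← Real.exp_nat_mul, ← Real.exp_add, show L - x = Real.log e by linarith]
      _ ≤ _ := by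
        rw [Real.exp_le_exp]
        -- By convexity `x ^ 2` lies below its chord on `[x₀, L]`; the resulting linear bound
        -- decreases in `x` by `h₁`, so `x = x₀` is the worst case.
        have h5 : 0 ≤ c * ((x - x₀) * (L - x)) :=
          mul_nonneg hc.le (mul_nonneg (by linarith) (by linarith))
        have h6 := mul_le_mul_of_nonneg_right hx₀x h₁
        nlinarith
  have hcard : ((shortPairs J n).card : ℝ) ≤ n ^ 2 := by
    have : (shortPairs J n).card ≤ (n / 2 + 1) * (n / 2 + 1) := by
      refine (Finset.card_filter_le _ _).trans ?_
      rw [Finset.card_product, Finset.card_range]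
    have h2 : (n / 2 + 1) * (n / 2 + 1) ≤ n * n := Nat.mul_le_mul (by omega) (by omega)
    rw [sq]
    exact_mod_cast this.trans h2
  have hsum := Finset.sum_le_card_nsmul _ _ _ hterm
  rw [nsmul_eq_mul] at hsum
  refine hsum.trans ((mul_le_mul_of_nonneg_right hcard (Real.exp_pos _).le).trans (le_of_eq ?_))
  rw [Real.exp_sub, Real.exp_sub, Real.exp_log two_pos, show 2 * L = L + L by ring, Real.exp_add,
    hL, Real.exp_log hn0]
  field_simp

theorem exists_weightSum_le {c : ℝ} (hc : 1 / (2 * Real.log 2) < c) (α : Type*) :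
    ∃ (J : ℕ) (C : ℝ), 1 ≤ C ∧
      ∀ n : ℕ, (weightSum α J n : ℝ) ≤ C * Real.exp (c * Real.log n ^ 2) := by
  have hlog2 : 0 < Real.log 2 := Real.log_pos one_lt_two
  have hc0 : 0 < c := lt_trans (by positivity) hc
  have hc2 : 1 < 2 * c * Real.log 2 := by
    rw [div_lt_iff₀ (by positivity)] at hc
    linarith
  -- The product tends to `2 * c * log 2 > 1` as `J` grows.
  obtain ⟨J, hJ⟩ : ∃ J : ℕ, 1 < c * (2 * Real.log 2 - Real.log (1 + 2 / 2 ^ J)) := by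
    have h1 : Filter.Tendsto (fun J : ℕ => (2 : ℝ) / 2 ^ J) Filter.atTop (nhds 0) :=
      tendsto_const_nhds.div_atTop (tendsto_pow_atTop_atTop_of_one_lt one_lt_two)
    have h2 : Filter.Tendsto (fun J : ℕ => Real.log (1 + (2 : ℝ) / 2 ^ J)) Filter.atTop
        (nhds 0) := by
      have := (h1.const_add 1).log (by norm_num)
      simpa using this
    have h3 := (h2.const_sub (2 * Real.log 2)).const_mul c
    exact (h3.eventually_const_lt (by linarith)).exists
  obtain ⟨x₀, hx₀⟩ : ∃ x₀, x₀ = 2 * Real.log 2 - Real.log (1 + 2 / 2 ^ J) := ⟨_, rfl⟩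
  rw [← hx₀] at hJ
  obtain ⟨A, hA⟩ : ∃ A : ℝ, A = 2 ^ J + 4 ^ (J + 1) := ⟨_, rfl⟩
  have hA0 : 0 < A := by rw [hA]; positivity
  have hlog : Filter.Tendsto (fun n : ℕ => Real.log n) Filter.atTop Filter.atTop :=
    Real.tendsto_log_atTop.comp tendsto_natCast_atTop_atTop
  have ev : ∀ a b : ℝ, 0 < b → ∀ᶠ n : ℕ in Filter.atTop, a ≤ b * Real.log n := fun a b hb =>
    (hlog.const_mul_atTop hb).eventually_ge_atTop a
  have hev := (Filter.eventually_ge_atTop 2).and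
    ((ev (Real.log (2 * A) + c * Real.log 2 ^ 2) (2 * c * Real.log 2 - 1) (by linarith)).and
      ((ev x₀ 1 one_pos).and ((ev (c * x₀ + J) c hc0).and
        (ev ((J + 1) * Real.log 2 + c * x₀ ^ 2 + J * x₀) (2 * c * x₀ - 2) (by linarith)))))
  obtain ⟨N, hN⟩ := Filter.eventually_atTop.1 hev
  obtain ⟨C, hC⟩ : ∃ C : ℝ, C = 1 + ∑ n ∈ Finset.range N, (weightSum α J n : ℝ) := ⟨_, rfl⟩
  have hC1 : 1 ≤ C := by
    rw [hC, le_add_iff_nonneg_right]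
    positivity
  refine ⟨J, C, hC1, fun n => ?_⟩
  induction n using Nat.strong_induction_on with
  | _ n ih =>
    rcases lt_or_ge n N with hnN | hnN
    · have h1 : (weightSum α J n : ℝ) ≤ C := by
        have := Finset.single_le_sum (f := fun n => (weightSum α J n : ℝ))
          (fun i _ => Nat.cast_nonneg _) (Finset.mem_range.2 hnN)
        rw [hC]
        linarith
      have h2 : 1 ≤ Real.exp (c * Real.log n ^ 2) := Real.one_le_exp (by positivity)
      nlinarith
    · obtain ⟨hn2, h1, h2, h3, h4⟩ := hN n hnN
      have hrec : (weightSum α J n : ℝ) ≤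
          A * ∑ e ∈ Finset.range (n / 2 + 1), (weightSum α J e : ℝ) +
            ∑ q ∈ shortPairs J n, ((n / q.1 : ℕ) + 1 : ℝ) ^ J * (weightSum α J q.2 : ℝ) := by
        rw [hA]
        exact_mod_cast weightSum_le (α := α) (by omega) J
      have hs1 : ∑ e ∈ Finset.range (n / 2 + 1), (weightSum α J e : ℝ) ≤
          C * ∑ e ∈ Finset.range (n / 2 + 1), Real.exp (c * Real.log e ^ 2) := by
        rw [Finset.mul_sum]
        refine Finset.sum_le_sum fun e he => ih e ?_
        rw [Finset.mem_range] at he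
        omega
      have hs2 : ∑ q ∈ shortPairs J n, ((n / q.1 : ℕ) + 1 : ℝ) ^ J * (weightSum α J q.2 : ℝ) ≤
          C * ∑ q ∈ shortPairs J n,
            ((n / q.1 : ℕ) + 1 : ℝ) ^ J * Real.exp (c * Real.log q.2 ^ 2) := by
        rw [Finset.mul_sum]
        refine Finset.sum_le_sum fun q hq => ?_
        have hq2 : q.2 < n := by
          simp only [shortPairs, Finset.mem_filter, Finset.mem_product, Finset.mem_range] at hq
          omega
        calc ((n / q.1 : ℕ) + 1 : ℝ) ^ J * (weightSum α J q.2 : ℝ)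
            ≤ ((n / q.1 : ℕ) + 1 : ℝ) ^ J * (C * Real.exp (c * Real.log q.2 ^ 2)) := by
              gcongr
              exact ih q.2 hq2
          _ = _ := by ring
      -- Each sum contributes at most half the target, so the induction closes with the same `C`.
      have hb1 := sum_exp_sq_log_le hc0 hA0 hn2 rfl h1
      have hb2 := sum_shortPairs_le hc0 hn2 rfl (by linarith) hx₀ (by linarith) h4
      have hs1' := mul_le_mul_of_nonneg_left hs1 hA0.le
      have hb1' := mul_le_mul_of_nonneg_left hb1 (zero_le_one.trans hC1)
      have hb2' := mul_le_mul_of_nonneg_left hb2 (zero_le_one.trans hC1)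
      linarith

theorem eventually_log_kappa_le [Nonempty α] {c : ℝ} (hc : 1 / (2 * Real.log 2) < c) :
    ∀ᶠ n : ℕ in Filter.atTop, Real.log (kappa α n) / Real.log n ^ 2 ≤ c := by
  obtain ⟨d, hd, hdc⟩ := exists_between hc
  obtain ⟨J, C, hC, h⟩ := exists_weightSum_le hd α
  have hlog : Filter.Tendsto (fun n : ℕ => Real.log n) Filter.atTop Filter.atTop :=
    Real.tendsto_log_atTop.comp tendsto_natCast_atTop_atTop
  have hsq : Filter.Tendsto (fun n : ℕ => Real.log n ^ 2) Filter.atTop Filter.atTop :=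
    (Filter.tendsto_pow_atTop two_ne_zero).comp hlog
  filter_upwards [hlog.eventually_gt_atTop 0,
    (hsq.const_mul_atTop (sub_pos.2 hdc)).eventually_ge_atTop (Real.log C)] with n hn hCn
  rw [div_le_iff₀ (by positivity)]
  have hle : (kappa α n : ℝ) ≤ C * Real.exp (d * Real.log n ^ 2) := by
    refine le_trans ?_ (h n)
    rw [kappa_eq_card]
    exact_mod_cast card_le_weightSum J n
  have hpos : (0 : ℝ) < kappa α n := by
    rw [kappa_eq_card, Nat.cast_pos, Finset.card_pos]
    exact ⟨_, mem_borderSets.2 ⟨fun _ => Classical.arbitrary α, rfl⟩⟩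
  have := Real.log_le_log hpos hle
  rw [Real.log_mul (by positivity) (Real.exp_pos _).ne', Real.log_exp] at this
  linarith

/-! ### Lower bound by the words `v bᵐ v` -/

/-- The word `v bᵐ v`, where `v` is the prefix of `u` of length `e`. -/
def sandwich (u : ℕ → α) (b : α) (e m : ℕ) : ℕ → α := fun j =>
  if j < e then u j else if j < e + m then b else u (j - (e + m))

/-- The prefix of length `n` of `u` starts and ends with letters other than `b` and has no run
of `m` letters `b`. -/
def RunFree (u : ℕ → α) (b : α) (n m : ℕ) : Prop :=
  u 0 ≠ b ∧ u (n - 1) ≠ b ∧ ∀ i, i + m ≤ n → ∃ j < m, u (i + j) ≠ b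

theorem RunFree.mono {u : ℕ → α} {b : α} {n m m' : ℕ} (h : RunFree u b n m) (hm : m ≤ m') :
    RunFree u b n m' := by
  refine ⟨h.1, h.2.1, fun i hi => ?_⟩
  obtain ⟨j, hj, hu⟩ := h.2.2 i (by omega)
  exact ⟨j, by omega, hu⟩

theorem sandwich_add {u : ℕ → α} {b : α} {e m : ℕ} (j : ℕ) :
    sandwich u b e m (e + m + j) = u j := by
  rw [sandwich, if_neg (by omega), if_neg (by omega), Nat.add_sub_cancel_left]

theorem sandwich_of_lt {u : ℕ → α} {b : α} {e m j : ℕ} (hj : j < e) :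
    sandwich u b e m j = u j := if_pos hj

theorem sandwich_middle {u : ℕ → α} {b : α} {e m j : ℕ} (h₁ : e ≤ j) (h₂ : j < e + m) :
    sandwich u b e m j = b := by
  rw [sandwich, if_neg (by omega), if_pos h₂]

/-- A run of `m` letters `b` occurs only once in `v bᵐ v`. -/
theorem eq_of_sandwich_run {u : ℕ → α} {b : α} {e m i : ℕ} (he : 0 < e) (h : RunFree u b e m)
    (hi : i + m ≤ 2 * e + m) (hrun : ∀ j < m, sandwich u b e m (i + j) = b) : i = e := by
  by_contra hne
  rcases lt_or_gt_of_ne hne with hlt | hgt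
  · by_cases hie : i + m ≤ e
    · obtain ⟨j, hj, hu⟩ := h.2.2 i hie
      exact hu (by rw [← hrun j hj, sandwich_of_lt (by omega)])
    · have := hrun (e - 1 - i) (by omega)
      rw [show i + (e - 1 - i) = e - 1 by omega, sandwich_of_lt (by omega)] at this
      exact h.2.1 this
  · by_cases hie : i < e + m
    · have := hrun (e + m - i) (by omega)
      rw [show i + (e + m - i) = e + m + 0 by omega, sandwich_add] at this
      exact h.1 this
    · obtain ⟨j, hj, hu⟩ := h.2.2 (i - (e + m)) (by omega)
      refine hu ?_
      rw [← hrun j hj, show i + j = e + m + (i - (e + m) + j) by omega, sandwich_add]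

/-- A run of `m + 1` letters `b` would contain runs of `m` at two positions. -/
theorem RunFree.sandwich {u : ℕ → α} {b : α} {e m : ℕ} (he : 0 < e) (h : RunFree u b e m) :
    RunFree (sandwich u b e m) b (2 * e + m) (m + 1) := by
  refine ⟨by rw [sandwich_of_lt he]; exact h.1, ?_, fun i hi => ?_⟩
  · rw [show 2 * e + m - 1 = e + m + (e - 1) by omega, sandwich_add]
    exact h.2.1
  · by_contra! hrun
    have h₁ := eq_of_sandwich_run he h (i := i) (by omega) fun j hj => hrun j (by omega)
    have h₂ := eq_of_sandwich_run he h (i := i + 1) (by omega) fun j hj => by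
      rw [add_assoc]
      exact hrun (1 + j) (by omega)
    omega

theorem isBorder_congr {u v : ℕ → α} {n : ℕ} (h : ∀ i < n, u i = v i) (b : ℕ) :
    IsBorder u n b ↔ IsBorder v n b := by
  refine and_congr_right fun hb => forall₂_congr fun i hi => ?_
  rw [h i (by omega), h (n - b + i) (by omega)]

/-- A proper border longer than `e` either starts, as a suffix, inside the block `bᵐ`, although `v`
does not start with `b`, or is long enough to copy that block to a second place. -/
theorem borderSet_sandwich {u : ℕ → α} {b : α} {e m : ℕ} (he : 0 < e) (h : RunFree u b e m) :
    borderSet (sandwich u b e m) (2 * e + m) = insert (2 * e + m) (borderSet u e) := by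
  have hborder : IsBorder (sandwich u b e m) (2 * e + m) e :=
    ⟨by omega, fun i hi => by
      rw [sandwich_of_lt hi, show 2 * e + m - e + i = e + m + i by omega, sandwich_add]⟩
  have hprefix : ∀ c, IsBorder (sandwich u b e m) e c ↔ IsBorder u e c :=
    isBorder_congr fun i hi => sandwich_of_lt hi
  ext c
  rw [Finset.mem_insert, mem_borderSet, mem_borderSet, ← hprefix]
  constructor
  · intro hc
    rcases hc.1.eq_or_lt with hcn | hcn
    · exact Or.inl hcn
    right
    by_cases hce : c ≤ e
    · exact (hborder.iff_of_le hce).2 hc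
    exfalso
    by_cases hcm : c < e + m
    · have := hc.2 0 (by omega)
      rw [sandwich_of_lt he, sandwich_middle (by omega) (by omega)] at this
      exact h.1 this
    · have := eq_of_sandwich_run he h (i := 2 * e + m - c + e) (by omega) fun j hj => by
        rw [add_assoc, ← hc.2 (e + j) (by omega), sandwich_middle (by omega) (by omega)]
      omega
  · rintro (rfl | hc)
    · exact isBorder_self _ _
    · exact (hborder.iff_of_le hc.1).1 hc

/-- The length `e` is recovered as the largest element of its border set. -/
theorem insert_borderSet_injective {n e e' : ℕ} {u u' : ℕ → α} (he : e < n) (he' : e' < n)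
    (h : insert n (borderSet u e) = insert n (borderSet u' e')) :
    e = e' ∧ borderSet u e = borderSet u' e' := by
  have hn : n ∉ borderSet u e := fun h => by
    have := (mem_borderSet.1 h).1
    omega
  have hn' : n ∉ borderSet u' e' := fun h => by
    have := (mem_borderSet.1 h).1
    omega
  have hB : borderSet u e = borderSet u' e' := by
    rw [← Finset.erase_insert hn, h, Finset.erase_insert hn']
  refine ⟨le_antisymm ?_ ?_, hB⟩
  · exact (mem_borderSet.1 (hB ▸ mem_borderSet.2 (isBorder_self u e))).1
  · exact (mem_borderSet.1 (hB ▸ mem_borderSet.2 (isBorder_self u' e'))).1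

theorem exists_runFree_family [Nontrivial α] (b : α) (t : ℕ) :
    ∃ T : Finset (ℕ × Finset ℕ), T.card = 2 ^ (∑ i ∈ Finset.range t, i) ∧
      ∀ x ∈ T, 0 < x.1 ∧ x.1 ≤ (t + 1) * 2 ^ t ∧
        ∃ u : ℕ → α, RunFree u b x.1 (2 ^ t) ∧ borderSet u x.1 = x.2 := by
  induction t with
  | zero =>
    obtain ⟨a, ha⟩ := exists_ne b
    refine ⟨{(1, borderSet (fun _ => a) 1)}, by simp, fun x hx => ?_⟩
    obtain rfl := Finset.mem_singleton.1 hx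
    exact ⟨one_pos, by simp, fun _ => a, ⟨ha, ha, fun i _ => ⟨0, by simp, ha⟩⟩, rfl⟩
  | succ t ih =>
    obtain ⟨T, hcard, hT⟩ := ih
    have hpow : 2 ^ (t + 1) = 2 * 2 ^ t := by ring
    -- The block length lies in `[2 ^ t, 2 ^ (t + 1))`: long enough for the run-free hypothesis,
    -- short enough to preserve it at the next stage.
    refine ⟨(T ×ˢ Finset.range (2 ^ t)).image (fun y =>
      (2 * y.1.1 + (2 ^ t + y.2), insert (2 * y.1.1 + (2 ^ t + y.2)) y.1.2)), ?_, ?_⟩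
    · rw [Finset.card_image_of_injOn, Finset.card_product, hcard, Finset.card_range,
        Finset.sum_range_succ, pow_add]
      rintro ⟨⟨e, B⟩, m⟩ hx ⟨⟨e', B'⟩, m'⟩ hx' heq
      simp only [Finset.coe_product, Set.mem_prod, Finset.mem_coe, Prod.mk.injEq] at hx hx' heq ⊢
      obtain ⟨h0, -, u, hu, huB⟩ := hT _ hx.1
      obtain ⟨h0', -, u', hu', huB'⟩ := hT _ hx'.1
      simp only at h0 h0' huB huB'
      obtain ⟨hlen, hins⟩ := heq
      rw [← hlen, ← huB, ← huB'] at hins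
      obtain ⟨h1, h2⟩ := insert_borderSet_injective (by omega) (by omega) hins
      exact ⟨⟨h1, by rw [← huB, ← huB', h2]⟩, by omega⟩
    · intro x hx
      obtain ⟨⟨⟨e, B⟩, m⟩, hy, rfl⟩ := Finset.mem_image.1 hx
      simp only [Finset.mem_product, Finset.mem_range] at hy
      obtain ⟨h0, hle, u, hu, huB⟩ := hT _ hy.1
      simp only at h0 hle hu huB ⊢
      have hu' := hu.mono (Nat.le_add_right (2 ^ t) m)
      refine ⟨by omega, ?_, sandwich u b e (2 ^ t + m), (hu'.sandwich h0).mono (by omega), ?_⟩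
      · rw [hpow]
        nlinarith
      · rw [borderSet_sandwich h0 hu', huB]

/-- One last block of length `n - 2 * e ≥ 2 ^ t` brings all members of the family to the common
length `n`. -/
theorem two_pow_le_kappa [Nontrivial α] {n t : ℕ} (hn : (2 * t + 3) * 2 ^ t ≤ n) :
    2 ^ (∑ i ∈ Finset.range t, i) ≤ kappa α n := by
  obtain ⟨b, -⟩ := exists_pair_ne α
  obtain ⟨T, hcard, hT⟩ := exists_runFree_family b t
  have hpow : 0 < 2 ^ t := by positivity
  rw [kappa_eq_card, ← hcard]
  refine Finset.card_le_card_of_injOn (fun x => insert n x.2) ?_ ?_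
  · rintro ⟨e, B⟩ hx
    obtain ⟨h0, hle, u, hu, huB⟩ := hT _ hx
    simp only at h0 hle hu huB ⊢
    obtain ⟨m, hm⟩ : ∃ m, n = 2 * e + m := 
      ⟨n - 2 * e, by nlinarith [Nat.sub_add_cancel (show 2 * e ≤ n by nlinarith)]⟩
    refine mem_borderSets.2 ⟨sandwich u b e m, ?_⟩
    rw [hm, borderSet_sandwich h0 (hu.mono (by nlinarith)), huB]
  · rintro ⟨e, B⟩ hx ⟨e', B'⟩ hx' heq
    obtain ⟨h0, hle, u, hu, huB⟩ := hT _ hx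
    obtain ⟨h0', hle', u', hu', huB'⟩ := hT _ hx'
    simp only at h0 hle hle' h0' huB huB' heq
    rw [← huB, ← huB'] at heq
    obtain ⟨h1, h2⟩ := insert_borderSet_injective (by nlinarith) (by nlinarith) heq
    rw [Prod.mk.injEq, ← huB, ← huB']
    exact ⟨h1, h2⟩

/-! ### Asymptotics of the lower bound -/

theorem tendsto_log_ratio :
    Filter.Tendsto (fun t : ℕ => Real.log ((2 : ℝ) ^ (∑ i ∈ Finset.range t, i)) /
      Real.log (((2 * t + 5) * 2 ^ (t + 1) : ℕ) : ℝ) ^ 2) Filter.atTop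
      (nhds (1 / (2 * Real.log 2))) := by
  have hlog2 : 0 < Real.log 2 := Real.log_pos one_lt_two
  have hinv : Filter.Tendsto (fun t : ℕ => 1 / (t : ℝ)) Filter.atTop (nhds 0) :=
    tendsto_one_div_atTop_nhds_zero_nat
  have hlog : Filter.Tendsto (fun t : ℕ => Real.log (2 * t + 5) / t) Filter.atTop (nhds 0) := by
    have hlin : Filter.Tendsto (fun t : ℕ => 2 * (t : ℝ) + 5) Filter.atTop Filter.atTop :=
      Filter.tendsto_atTop_add_const_right _ _
        (tendsto_natCast_atTop_atTop.const_mul_atTop two_pos)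
    have h1 := (Real.isLittleO_log_id_atTop.tendsto_div_nhds_zero).comp hlin
    have h2 := h1.mul ((hinv.const_mul 5).const_add 2)
    simp only [zero_mul] at h2
    refine h2.congr' ?_
    filter_upwards [Filter.eventually_gt_atTop 0] with t ht
    have ht' : (0 : ℝ) < t := by exact_mod_cast ht
    simp only [Function.comp_apply, id]
    field_simp
  have hden : Filter.Tendsto (fun t : ℕ => Real.log (2 * t + 5) / t +
      (1 + 1 / (t : ℝ)) * Real.log 2) Filter.atTop (nhds (Real.log 2)) := by
    have := hlog.add ((hinv.const_add 1).mul_const (Real.log 2))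
    simpa using this
  have hnum : Filter.Tendsto (fun t : ℕ => (1 - 1 / (t : ℝ)) / 2 * Real.log 2) Filter.atTop
      (nhds (Real.log 2 / 2)) := by
    have := ((hinv.const_sub 1).div_const 2).mul_const (Real.log 2)
    convert this using 2
    ring
  have hlim := hnum.div (hden.pow 2) (by positivity)
  rw [show Real.log 2 / 2 / Real.log 2 ^ 2 = 1 / (2 * Real.log 2) by field_simp] at hlim
  refine hlim.congr' ?_
  filter_upwards [Filter.eventually_gt_atTop 0] with t ht
  have ht' : (0 : ℝ) < t := by exact_mod_cast ht
  have hsum : ((∑ i ∈ Finset.range t, i : ℕ) : ℝ) = t * (t - 1) / 2 := by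
    have h := Finset.sum_range_id_mul_two t
    have h' : ((∑ i ∈ Finset.range t, i : ℕ) : ℝ) * 2 = t * ((t - 1 : ℕ) : ℝ) := by
      exact_mod_cast h
    rw [Nat.cast_sub ht, Nat.cast_one] at h'
    linarith
  have hD : Real.log (((2 * t + 5) * 2 ^ (t + 1) : ℕ) : ℝ) =
      t * (Real.log (2 * t + 5) / t + (1 + 1 / (t : ℝ)) * Real.log 2) := by
    push_cast
    rw [Real.log_mul (by positivity) (by positivity), Real.log_pow]
    push_cast
    field_simp
  have hN : Real.log ((2 : ℝ) ^ (∑ i ∈ Finset.range t, i)) =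
      t ^ 2 * ((1 - 1 / (t : ℝ)) / 2 * Real.log 2) := by
    rw [Real.log_pow, hsum]
    field_simp
  simp only [Pi.div_apply]
  rw [hD, hN, mul_pow, mul_div_mul_left _ _ (by positivity)]

theorem eventually_lt_log_kappa [Nontrivial α] {c : ℝ} (hc : c < 1 / (2 * Real.log 2)) :
    ∀ᶠ n : ℕ in Filter.atTop, c < Real.log (kappa α n) / Real.log n ^ 2 := by
  obtain ⟨t₀, ht₀⟩ := Filter.eventually_atTop.1 (tendsto_log_ratio.eventually_const_lt hc)
  filter_upwards [Filter.eventually_ge_atTop ((2 * t₀ + 3) * 2 ^ t₀), Filter.eventually_gt_atTop 1]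
    with n hn hn1
  -- Take `t` maximal; the upper bound on `n` is the failure of the condition at `t + 1`.
  obtain ⟨t, ht₀t, htn, hnt⟩ : ∃ t, t₀ ≤ t ∧ (2 * t + 3) * 2 ^ t ≤ n ∧
      n < (2 * t + 5) * 2 ^ (t + 1) := by
    have hbound : ∀ t, (2 * t + 3) * 2 ^ t ≤ n → t ≤ n := fun t h => by
      have := Nat.one_le_two_pow (n := t)
      nlinarith
    refine ⟨Nat.findGreatest (fun t => (2 * t + 3) * 2 ^ t ≤ n) n,
      Nat.le_findGreatest (hbound _ hn) hn,
      Nat.findGreatest_spec (P := fun t => (2 * t + 3) * 2 ^ t ≤ n) (hbound _ hn) hn, ?_⟩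
    by_contra! h
    have h' : (2 * (Nat.findGreatest (fun t => (2 * t + 3) * 2 ^ t ≤ n) n + 1) + 3) *
        2 ^ (Nat.findGreatest (fun t => (2 * t + 3) * 2 ^ t ≤ n) n + 1) ≤ n := by
      linarith
    have := Nat.le_findGreatest (P := fun t => (2 * t + 3) * 2 ^ t ≤ n) (hbound _ h') h'
    omega
  refine (ht₀ t ht₀t).trans_le ?_
  have hn' : (1 : ℝ) < n := by exact_mod_cast hn1
  have hlogn : 0 < Real.log n := Real.log_pos hn'
  have hk : (2 : ℝ) ^ (∑ i ∈ Finset.range t, i) ≤ kappa α n := by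
    exact_mod_cast two_pow_le_kappa (α := α) htn
  have h1 : Real.log n ≤ Real.log (((2 * t + 5) * 2 ^ (t + 1) : ℕ) : ℝ) :=
    Real.log_le_log (by linarith) (by exact_mod_cast hnt.le)
  have h2 := Real.log_le_log (by positivity) hk
  have h3 : 0 ≤ Real.log ((2 : ℝ) ^ (∑ i ∈ Finset.range t, i)) :=
    Real.log_nonneg (one_le_pow₀ one_le_two)
  gcongr

end Autocorr

theorem mainTheorem2 (α : Type*) [Nontrivial α] :
    Filter.Tendsto (fun n : ℕ => Real.log (Autocorr.kappa α n : ℝ) / (Real.log (n : ℝ)) ^ 2)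
      Filter.atTop (nhds (1 / (2 * Real.log 2))) := by
  refine tendsto_order.2 ⟨fun c hc => Autocorr.eventually_lt_log_kappa hc, fun c hc => ?_⟩
  obtain ⟨d, hd, hdc⟩ := exists_between hc
  exact (Autocorr.eventually_log_kappa_le hd).mono fun n hn => hn.trans_lt hdc
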